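/- Conventions. A partially ordered ring is a unital ring $A$ (not assumed commutative) with a partial order that is translation invariant, satisfies $0 \le 1$, and for which products of elements of $A^+ = \{a : a \ge 0\}$ lie in $A^+$. An element $u \ge 0$ of a partially ordered abelian group $G$ is an order unit if for every $g \in G$ there is a positive integer $N$ with $-Nu \le g \le Nu$. A dimension group is a partially ordered abelian group $G$ that is directed ($G = G^+ - G^+$), unperforated (if $n$ is a positive integer and $ng \ge 0$, then $g \ge 0$) and has the Riesz decomposition property (if $a, b, c \ge 0$ and $a \le b + c$, then $a = b' + c'$ with $0 \le b' \le b$, $0 \le c' \le c$). A trace is a nonzero positive group homomorphism $\tau : G \to \mathbf{R}$; it is normalized for $(G,u)$ if $\tau(u) = 1$. $S(G,u) \subset \mathbf{R}^G$ is the set of normalized traces with the topology of pointwise convergence, and a pure (normalized) trace is an extreme point of $S(G,u)$. A dimension group $G$ with order unit $u$ is approximately divisible if no pure trace has cyclic image. A trace $\tau$ is order unit good if for all $a \in G^+ \setminus \{0\}$ and all order units $b$ with $\tau(a) < \tau(b)$ there is $c \in G$ with $0 \le c \le b$ and $\tau(c) = \tau(a)$. A Choquet simplex is a compact convex set that is a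 base of a cone which is a lattice in its own order; it is a Bauer simplex if its set of extreme points is closed. $\operatorname{Aff} K$ is the space of continuous affine functions $K \to \mathbf{R}$ with the supremum norm and the pointwise order. Proposition 3.1. Let $A$ be a partially ordered ring with $1$ as order unit whose ordered additive group is an approximately divisible dimension group. Then: (i) A normalized trace $\tau$ of $(A,1)$ is pure if and only if it is multiplicative, that is, $\tau(ab) = \tau(a)\tau(b)$ for all $a, b \in A$. (ii) $S(A,1)$ is a Bauer simplex, and, with $X$ the (compact) space of pure normalized traces of $(A,1)$ in the topology of pointwise convergence, the restriction map $f \mapsto f|_X$ is an isometric linear order isomorphism of $\operatorname{Aff} S(A,1)$ onto $C(X, \mathbf{R})$ with the supremum norm. (iii) A pure normalized trace $\tau$ is order unit good if and only if no pure normalized trace $\sigma \ne \tau$ vanishes on the ideal $\ker \tau$. -/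

import Mathlib

namespace DimGroup

section Groups

variable {G : Type*} [AddCommGroup G] [PartialOrder G]

/-- `u` is an order unit: `u ≥ 0`, and every `g` satisfies `-N u ≤ g ≤ N u` for some
positive integer `N`. -/
def IsOrderUnit (u : G) : Prop :=
  0 ≤ u ∧ ∀ g : G, ∃ N : ℕ, 0 < N ∧ -(N • u) ≤ g ∧ g ≤ N • u

variable (G) in
/-- A dimension group: a directed partially ordered abelian group which is unperforated and has
the Riesz decomposition property. (Translation invariance of the order is the class
`IsOrderedAddMonoid`, which accompanies this definition wherever it is used.) -/
structure IsDimensionGroup : Prop where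
  directed : ∀ g : G, ∃ a b : G, 0 ≤ a ∧ 0 ≤ b ∧ g = a - b
  riesz : ∀ a b c : G, 0 ≤ a → 0 ≤ b → 0 ≤ c → a ≤ b + c →
    ∃ b' c' : G, 0 ≤ b' ∧ b' ≤ b ∧ 0 ≤ c' ∧ c' ≤ c ∧ a = b' + c'
  unperforated : ∀ (n : ℕ) (g : G), 0 < n → 0 ≤ n • g → 0 ≤ g

/-- A trace: a nonzero positive group homomorphism to the reals. -/
def IsTrace (τ : G →+ ℝ) : Prop :=
  τ ≠ 0 ∧ ∀ a : G, 0 ≤ a → 0 ≤ τ a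

/-- A normalized trace of `(G, u)`. -/
def IsNormalizedTrace (u : G) (τ : G →+ ℝ) : Prop :=
  IsTrace τ ∧ τ u = 1

/-- The space `S(G, u)` of normalized traces, as a subset of `ℝ^G`; it is given the topology of
pointwise convergence. -/
def traceSpace (u : G) : Set (G → ℝ) :=
  {f | ∃ τ : G →+ ℝ, IsNormalizedTrace u τ ∧ f = ⇑τ}

/-- The set `∂ₑ S(G, u)` of extreme points of `S(G, u)`. -/
def pureTraceSpace (u : G) : Set (G → ℝ) :=
  (traceSpace u).extremePoints ℝ

/-- A pure normalized trace of `(G, u)`: an extreme point of `S(G, u)`. -/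
def IsPureTrace (u : G) (τ : G →+ ℝ) : Prop :=
  ⇑τ ∈ pureTraceSpace u

/-- `(G, u)` is approximately divisible: no pure trace is discrete, that is, has cyclic image. The
condition does not depend on the normalization of the pure traces. -/
def IsApproximatelyDivisible (u : G) : Prop :=
  ∀ τ : G →+ ℝ, IsPureTrace u τ → ¬ IsAddCyclic τ.range

/-- The trace `τ` is order unit good: if `a > 0`, `b` is an order unit and `τ a < τ b`, then
some `c` in the interval `[0, b]` satisfies `τ c = τ a`. -/
def IsOrderUnitGood (τ : G →+ ℝ) : Prop :=
  ∀ a b : G, 0 ≤ a → a ≠ 0 → IsOrderUnit b → τ a < τ b →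
    ∃ c : G, 0 ≤ c ∧ c ≤ b ∧ τ c = τ a

end Groups

section Convexity

variable {E : Type*} [AddCommGroup E] [Module ℝ E]

/-- The cone in `E × ℝ` generated by `K × {1}`, which is a base of it. -/
def coneOver (K : Set E) : Set (E × ℝ) :=
  {p | ∃ t : ℝ, 0 ≤ t ∧ ∃ x ∈ K, p = (t • x, t)}

/-- `C` is a lattice in its own order, in which `x ≤ y` means `y - x ∈ C`: any two elements of
`C` have a least upper bound in `C`. (For a convex cone, greatest lower bounds then exist as
well.) -/
def IsLatticeCone {F : Type*} [AddCommGroup F] (C : Set F) : Prop :=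
  ∀ x ∈ C, ∀ y ∈ C, ∃ z ∈ C, z - x ∈ C ∧ z - y ∈ C ∧
    ∀ w ∈ C, w - x ∈ C → w - y ∈ C → w - z ∈ C

/-- A Choquet simplex: a compact convex set that is a base of a lattice cone. -/
def IsChoquetSimplex [TopologicalSpace E] (K : Set E) : Prop :=
  IsCompact K ∧ Convex ℝ K ∧ IsLatticeCone (coneOver K)

/-- A Bauer simplex: a Choquet simplex whose set of extreme points is closed. -/
def IsBauerSimplex [TopologicalSpace E] (K : Set E) : Prop :=
  IsChoquetSimplex K ∧ IsClosed (K.extremePoints ℝ)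

/-- `Aff K`: the space of continuous affine real-valued functions on the convex set `K`. When `K`
is compact, it carries the supremum norm inherited from `C(K, ℝ)`. -/
def Aff [TopologicalSpace E] (K : Set E) : Submodule ℝ C(K, ℝ) where
  carrier := {f | ∀ (x y z : K) (a b : ℝ), 0 ≤ a → 0 ≤ b → a + b = 1 →
    (z : E) = a • (x : E) + b • (y : E) → f z = a * f x + b * f y}
  zero_mem' := by
    intro x y z a b _ _ _ _
    simp
  add_mem' := by
    intro f g hf hg x y z a b ha hb hab hz
    simp only [ContinuousMap.add_apply, hf x y z a b ha hb hab hz, hg x y z a b ha hb hab hz]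
    ring
  smul_mem' := by
    intro c f hf x y z a b ha hb hab hz
    simp only [ContinuousMap.smul_apply, smul_eq_mul, hf x y z a b ha hb hab hz]
    ring

end Convexity

end DimGroup

/-! The engine is extremality: a positive homomorphism dominated by a multiple of a pure trace is
proportional to it (`IsPureTrace.eq_smul_of_le`). Applied to `x ↦ τ (a * x)` with `0 ≤ a ≤ N • 1`,
this makes pure traces multiplicative. Krein–Milman spreads `f a ^ 2 ≤ f (a * a)` from pure traces
to all traces, and the equality case shows that a multiplicative trace is extreme. Hence the space
`X` of pure traces is closed; together with the Riesz–Kantorovich lattice structure on positive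
homomorphisms, this gives a Bauer simplex. Evaluations at ring elements are restrictions of affine
functions to `X` and form a separating multiplicative monoid, so Stone–Weierstrass, with the closed
range of an isometry, gives all of `C(X, ℝ)`.

For goodness, approximate divisibility puts every real constant in the closure of the evaluations
(`const_mem_closure_range_pureEval`). If no other pure trace vanishes on `ker τ`, Stone–Weierstrass
then makes `ker τ` dense among the functions vanishing at `τ` (`mem_closure_map_ker`). A kernel
element can thus move `a` uniformly close to a multiple of `b` lying strictly between `0` and `b` on
`X`, and strict positivity on `X` implies positivity in `A` (`nonneg_of_pureEval_pos`). Conversely,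
if `τ` is good and `σ` vanishes on `ker τ`, then `τ x > 0` implies `σ x ≥ 0`, which forces `σ = τ`.
-/

namespace DimGroup

open Set

/-! ### Existence of states on groups with order unit -/

section States

variable {G : Type*} [AddCommGroup G]

/-- An additive submonoid maximal among those that contain no negative multiple of `u` is total. -/
theorem total_of_maximal {u : G} {C : AddSubmonoid G}
    (hneg : ∀ m : ℕ, 0 < m → -(m • u) ∉ C)
    (hmax : ∀ D : AddSubmonoid G, (∀ m : ℕ, 0 < m → -(m • u) ∉ D) → C ≤ D → D ≤ C) (x : G) :
    x ∈ C ∨ -x ∈ C := by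
  have key : ∀ x : G, x ∉ C → ∃ k m : ℕ, 0 < m ∧ -(k • x) - m • u ∈ C := by
    intro x hx
    by_contra! hcon
    refine hx (hmax (C ⊔ AddSubmonoid.multiples x) ?_ le_sup_left
      (le_sup_right (a := C) (AddSubmonoid.mem_multiples x)))
    intro m hm hmem
    obtain ⟨c, hc, y, ⟨k, rfl⟩, hcy⟩ := AddSubmonoid.mem_sup.1 hmem
    refine hcon k m hm ?_
    have : -(k • x) - m • u = c := by
      simp only at hcy
      rw [sub_eq_add_neg, ← hcy]; abel
    rwa [this]
  by_contra! hcon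
  obtain ⟨k, m, hm, h₁⟩ := key x hcon.1
  obtain ⟨k', m', hm', h₂⟩ := key (-x) hcon.2
  rcases Nat.eq_zero_or_pos k with rfl | hk
  · exact hneg m hm (by simpa using h₁)
  -- Add `k'` copies of the first relation to `k` copies of the second: the multiples of `x` cancel,
  -- and `k > 0` keeps the coefficient of `u` nonzero.
  · refine hneg (k' * m + k * m') (by positivity) ?_
    have := C.add_mem (C.nsmul_mem h₁ k') (C.nsmul_mem h₂ k)
    convert this using 1
    simp only [smul_sub, smul_neg, neg_neg, ← mul_smul, add_smul]
    rw [mul_comm k' k]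
    abel

/-- Existence of states for a preordered abelian group with order unit. -/
theorem exists_state {u : G} {C : AddSubmonoid G}
    (hneg : ∀ m : ℕ, 0 < m → -(m • u) ∉ C) (hunit : ∀ x : G, ∃ N : ℕ, N • u - x ∈ C) (hu : u ∈ C) :
    ∃ s : G →+ ℝ, s u = 1 ∧ ∀ x ∈ C, 0 ≤ s x := by
  obtain ⟨D, hCD, hD⟩ := zorn_le_nonempty₀
    {D : AddSubmonoid G | ∀ m : ℕ, 0 < m → -(m • u) ∉ D} (by
      intro c hc hchain D hD
      refine ⟨sSup c, ?_, fun E hE => le_sSup hE⟩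
      intro m hm hmem
      obtain ⟨E, hE, hmE⟩ := (AddSubmonoid.mem_sSup_of_directedOn ⟨D, hD⟩ hchain.directedOn).1 hmem
      exact hc hE m hm hmE) C hneg
  have hnegD : ∀ m : ℕ, 0 < m → -(m • u) ∉ D := hD.prop
  have htot := total_of_maximal hnegD (fun E hE hDE => hD.le_of_ge hE hDE)
  have huD : u ∈ D := hCD hu
  have hzneg : ∀ j : ℤ, j • u ∈ D → 0 ≤ j := by
    intro j hj
    by_contra! h
    refine hnegD (-j).toNat (by lia) ?_
    rw [← natCast_zsmul, Int.toNat_of_nonneg (by lia)]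
    simpa using hj
  -- The state is the Dedekind cut `x ↦ sSup (L x)`. It is superadditive for any such cone; totality
  -- of `D` supplies the reverse inequality.
  let L : G → Set ℝ := fun x => {r | ∃ (n : ℕ) (m : ℤ), 0 < n ∧ r = m / n ∧ n • x - m • u ∈ D}
  have hbdd : ∀ x, BddAbove (L x) := by
    intro x
    obtain ⟨N, hN⟩ := hunit x
    refine ⟨N, ?_⟩
    rintro r ⟨n, m, hn, rfl, hm⟩
    have h := D.add_mem (D.nsmul_mem (hCD hN) n) hm
    have : n • (N • u - x) + (n • x - m • u) = ((n * N : ℕ) - m : ℤ) • u := by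
      rw [sub_smul, smul_sub, ← mul_smul, natCast_zsmul]; abel
    rw [this] at h
    have h' : m ≤ ((n * N : ℕ) : ℤ) := by linarith [hzneg _ h]
    have h'' : (m : ℝ) ≤ n * N := by exact_mod_cast h'
    rw [div_le_iff₀ (by exact_mod_cast hn)]
    linarith
  have hne : ∀ x, (L x).Nonempty := by
    intro x
    obtain ⟨N, hN⟩ := hunit (-x)
    refine ⟨_, 1, -N, one_pos, rfl, ?_⟩
    have := hCD hN
    simpa [add_comm] using this
  have hsuper : ∀ x y, sSup (L x) + sSup (L y) ≤ sSup (L (x + y)) := by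
    intro x y
    rw [← le_sub_iff_add_le]
    refine csSup_le (hne x) ?_
    rintro _ ⟨n, m, hn, rfl, hm⟩
    rw [le_sub_iff_add_le, ← le_sub_iff_add_le']
    refine csSup_le (hne y) ?_
    rintro _ ⟨n', m', hn', rfl, hm'⟩
    rw [le_sub_iff_add_le']
    refine le_csSup (hbdd _) ⟨n * n', m * n' + m' * n, by positivity, ?_, ?_⟩
    · have : (n : ℝ) ≠ 0 := by positivity
      have : (n' : ℝ) ≠ 0 := by positivity
      push_cast
      field_simp
    · have := D.add_mem (D.nsmul_mem hm n') (D.nsmul_mem hm' n)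
      convert this using 1
      simp only [smul_sub, smul_add, ← natCast_zsmul, ← mul_smul, add_smul]
      push_cast
      rw [mul_comm (n' : ℤ) n, mul_comm (n' : ℤ) m, mul_comm (n : ℤ) m']
      abel
  have hodd : ∀ x, -sSup (L x) ≤ sSup (L (-x)) := by
    intro x
    by_contra! h
    -- By totality, `q` lies in `L x` or `-q` lies in `L (-x)`; either contradicts the choice of
    -- `q`.
    obtain ⟨q, hq₁, hq₂⟩ := exists_rat_btwn (lt_neg_of_lt_neg h)
    have hq : (q : ℝ) = (q.num : ℝ) / (q.den : ℝ) := by exact_mod_cast (Rat.num_div_den q).symm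
    rcases htot (q.den • x - q.num • u) with h' | h'
    · have : (q : ℝ) ≤ sSup (L x) := le_csSup (hbdd x) ⟨q.den, q.num, q.pos, hq, h'⟩
      linarith
    · have : -(q : ℝ) ≤ sSup (L (-x)) := by
        refine le_csSup (hbdd _) ⟨q.den, -q.num, q.pos, ?_, ?_⟩
        · rw [hq]; push_cast; ring
        · convert h' using 1
          simp only [smul_neg, neg_smul]; abel
      linarith
  refine ⟨AddMonoidHom.mk' (fun x => sSup (L x)) fun x y => le_antisymm ?_ (hsuper x y), ?_, ?_⟩
  · have h₁ := hsuper (x + y) (-y)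
    have h₂ := hodd y
    rw [add_neg_cancel_right] at h₁
    linarith
  · change sSup (L u) = 1
    refine le_antisymm (csSup_le (hne u) ?_) (le_csSup (hbdd u) ⟨1, 1, one_pos, by simp, by simp⟩)
    rintro _ ⟨n, m, hn, rfl, hm⟩
    rw [← natCast_zsmul, ← sub_smul] at hm
    have h := hzneg _ hm
    have h' : (m : ℝ) ≤ n := by exact_mod_cast sub_nonneg.1 h
    rw [div_le_one (by exact_mod_cast hn)]
    exact h'
  · intro x hx
    exact le_csSup (hbdd x) ⟨1, 0, one_pos, by simp, by simpa using hCD hx⟩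

variable [PartialOrder G]

theorem IsOrderUnit.eq_zero {u : G} (hu : IsOrderUnit u) (h : u = 0) (x : G) : x = 0 := by
  obtain ⟨N, -, h₁, h₂⟩ := hu.2 x
  subst h
  exact le_antisymm (by simpa using h₂) (by simpa using h₁)

variable [IsOrderedAddMonoid G]

theorem IsOrderUnit.zero_of_neg_smul_nonneg {u : G} (hu : IsOrderUnit u) {m : ℕ} (hm : 0 < m)
    (h : 0 ≤ -(m • u)) : u = 0 := by
  refine le_antisymm ?_ hu.1
  have h₁ : u ≤ m • u := by
    simpa using nsmul_le_nsmul_left hu.1 (Nat.one_le_iff_ne_zero.2 hm.ne')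
  exact h₁.trans (neg_nonneg.1 h)

/-- In an unperforated group with order unit, an element on which every normalized trace is
positive is positive. -/
theorem nonneg_of_forall_trace_pos {u : G} (hu : IsOrderUnit u)
    (hperf : ∀ (n : ℕ) (g : G), 0 < n → 0 ≤ n • g → 0 ≤ g) {a : G}
    (ha : ∀ τ : G →+ ℝ, IsNormalizedTrace u τ → 0 < τ a) : 0 ≤ a := by
  by_contra hcon
  have hu0 : u ≠ 0 := fun h => hcon (hu.eq_zero h a).ge
  -- Adjoin `-a` to the positive cone. Unperforation keeps the negative multiples of `u` out, so
  -- some state has `s a ≤ 0`.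
  have hneg : ∀ m : ℕ, 0 < m →
      -(m • u) ∉ AddSubmonoid.nonneg G ⊔ AddSubmonoid.multiples (-a) := by
    intro m hm hmem
    obtain ⟨c, hc, y, ⟨k, rfl⟩, hcy⟩ := AddSubmonoid.mem_sup.1 hmem
    have hc' : 0 ≤ c := hc
    simp only [smul_neg] at hcy
    rcases Nat.eq_zero_or_pos k with rfl | hk
    · refine hu0 (hu.zero_of_neg_smul_nonneg hm ?_)
      rw [← hcy]; simpa using hc'
    · refine hcon (hperf k a hk ?_)
      have : k • a = c + m • u := by
        have h := congrArg (fun t => t + k • a + m • u) hcy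
        simp only [neg_add_cancel_right] at h
        rw [h]; abel
      rw [this]
      exact add_nonneg hc' (nsmul_nonneg hu.1 m)
  obtain ⟨s, hs₁, hs₂⟩ := exists_state hneg (fun x => by
    obtain ⟨N, -, -, h⟩ := hu.2 x
    exact ⟨N, AddSubmonoid.mem_sup_left (sub_nonneg.2 h)⟩) (AddSubmonoid.mem_sup_left hu.1)
  refine (ha s ⟨⟨?_, fun x hx => hs₂ x (AddSubmonoid.mem_sup_left hx)⟩, hs₁⟩).not_ge ?_
  · rintro rfl
    simp at hs₁
  · have := hs₂ (-a) (AddSubmonoid.mem_sup_right (AddSubmonoid.mem_multiples _))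
    simpa using this

end States

/-! ### The compact convex set of normalized traces -/

section TraceSpace

variable {G : Type*} [AddCommGroup G] [PartialOrder G]

theorem isNormalizedTrace_iff {u : G} {τ : G →+ ℝ} :
    IsNormalizedTrace u τ ↔ (∀ a, 0 ≤ a → 0 ≤ τ a) ∧ τ u = 1 := by
  refine ⟨fun h => ⟨h.1.2, h.2⟩, fun h => ⟨⟨?_, h.1⟩, h.2⟩⟩
  rintro rfl
  simpa using h.2

theorem coe_mem_traceSpace {u : G} {τ : G →+ ℝ} :
    ⇑τ ∈ traceSpace u ↔ IsNormalizedTrace u τ := by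
  refine ⟨?_, fun h => ⟨τ, h, rfl⟩⟩
  rintro ⟨σ, hσ, h⟩
  rwa [DFunLike.coe_injective h]

theorem mem_traceSpace_iff {u : G} {f : G → ℝ} :
    f ∈ traceSpace u ↔ (∀ a b, f (a + b) = f a + f b) ∧ (∀ a, 0 ≤ a → 0 ≤ f a) ∧ f u = 1 := by
  constructor
  · rintro ⟨τ, hτ, rfl⟩
    exact ⟨map_add τ, isNormalizedTrace_iff.1 hτ⟩
  · rintro ⟨h₁, h₂⟩
    exact ⟨AddMonoidHom.mk' f h₁, isNormalizedTrace_iff.2 h₂, rfl⟩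

theorem IsPureTrace.isNormalizedTrace {u : G} {τ : G →+ ℝ} (h : IsPureTrace u τ) :
    IsNormalizedTrace u τ :=
  coe_mem_traceSpace.1 (extremePoints_subset h)

theorem convex_traceSpace (u : G) : Convex ℝ (traceSpace u) := by
  intro f hf g hg s t hs ht hst
  rw [mem_traceSpace_iff] at *
  refine ⟨fun a b => ?_, fun a ha => ?_, ?_⟩
  · simp only [Pi.add_apply, Pi.smul_apply, smul_eq_mul, hf.1, hg.1]; ring
  · have := hf.2.1 a ha
    have := hg.2.1 a ha
    simp only [Pi.add_apply, Pi.smul_apply, smul_eq_mul]; positivity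
  · simp only [Pi.add_apply, Pi.smul_apply, smul_eq_mul, hf.2.2, hg.2.2]; linarith

theorem isClosed_traceSpace (u : G) : IsClosed (traceSpace u) := by
  have : traceSpace u = (⋂ (a) (b), {f : G → ℝ | f (a + b) = f a + f b}) ∩
      ((⋂ (a) (_ : 0 ≤ a), {f : G → ℝ | 0 ≤ f a}) ∩ {f : G → ℝ | f u = 1}) := by
    ext f
    simp [mem_traceSpace_iff]
  rw [this]
  refine IsClosed.inter (isClosed_iInter fun a => isClosed_iInter fun b => isClosed_eq ?_ ?_)
    (IsClosed.inter (isClosed_iInter fun a => isClosed_iInter fun _ => isClosed_le ?_ ?_)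
      (isClosed_eq ?_ ?_)) <;> fun_prop

/-- A positive homomorphism dominated by a multiple of a pure trace is proportional to it. -/
theorem IsPureTrace.eq_smul_of_le {u : G} {τ : G →+ ℝ} (hτ : IsPureTrace u τ) (hu0 : 0 ≤ u)
    {ρ : G →+ ℝ}
    (h₀ : ∀ a, 0 ≤ a → 0 ≤ ρ a) {N : ℕ} (hN : ∀ a, 0 ≤ a → ρ a ≤ N * τ a) (a : G) :
    ρ a = ρ u * τ a := by
  obtain ⟨hpos, hone⟩ := isNormalizedTrace_iff.1 hτ.isNormalizedTrace
  have hρu : 0 ≤ ρ u := h₀ u hu0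
  have hρu' : ρ u ≤ N := by simpa [hone] using hN u hu0
  have hp : (0 : ℝ) < N + 1 - ρ u := by linarith
  -- Split `(N + 2) τ` as `(ρ + τ) + ((N + 1) τ - ρ)`. The extra copies of `τ` keep both normalizing
  -- constants positive even when `ρ u` is `0` or `N`.
  have hmem₁ : (fun a => (ρ u + 1)⁻¹ * (ρ a + τ a)) ∈ traceSpace u := by
    refine mem_traceSpace_iff.2 ⟨fun a b => ?_, fun a ha => ?_, ?_⟩
    · simp only [map_add]; ring
    · have := h₀ a ha
      have := hpos a ha
      positivity
    · rw [hone]; field_simp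
  have hmem₂ : (fun a => (N + 1 - ρ u)⁻¹ * ((N + 1) * τ a - ρ a)) ∈ traceSpace u := by
    refine mem_traceSpace_iff.2 ⟨fun a b => ?_, fun a ha => ?_, ?_⟩
    · simp only [map_add]; ring
    · have := hN a ha
      have := hpos a ha
      have : 0 ≤ (N + 1) * τ a - ρ a := by linarith
      positivity
    · rw [hone]; field_simp
  have hseg : ⇑τ ∈ openSegment ℝ (fun a => (ρ u + 1)⁻¹ * (ρ a + τ a))
      (fun a => (N + 1 - ρ u)⁻¹ * ((N + 1) * τ a - ρ a)) := by
    refine ⟨(ρ u + 1) / (N + 2), (N + 1 - ρ u) / (N + 2), by positivity, by positivity, ?_, ?_⟩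
    · field_simp; ring
    · ext a
      simp only [Pi.add_apply, Pi.smul_apply, smul_eq_mul]
      field_simp
      ring
  have h := congrFun (hτ.2 hmem₁ hmem₂ hseg) a
  field_simp at h
  linarith

variable [IsOrderedAddMonoid G]

theorem map_le_of_nonneg {τ : G →+ ℝ} (hτ : ∀ a, 0 ≤ a → 0 ≤ τ a) {a b : G} (h : a ≤ b) :
    τ a ≤ τ b := by
  have := hτ (b - a) (sub_nonneg.2 h)
  rw [map_sub] at this
  linarith

theorem isCompact_traceSpace {u : G} (hu : IsOrderUnit u) : IsCompact (traceSpace u) := by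
  choose N _ hN₁ hN₂ using hu.2
  refine (isCompact_univ_pi fun g => isCompact_Icc (a := -(N g : ℝ)) (b := N g)).of_isClosed_subset
    (isClosed_traceSpace u) ?_
  rintro _ ⟨τ, hτ, rfl⟩ g -
  obtain ⟨h₁, h₂⟩ := isNormalizedTrace_iff.1 hτ
  have h₃ := map_le_of_nonneg h₁ (hN₁ g)
  have h₄ := map_le_of_nonneg h₁ (hN₂ g)
  simp only [map_neg, map_nsmul, h₂, nsmul_eq_mul, mul_one] at h₃ h₄
  exact ⟨h₃, h₄⟩

theorem closure_convexHull_pureTraceSpace {u : G} (hu : IsOrderUnit u) :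
    closure (convexHull ℝ (pureTraceSpace u)) = traceSpace u :=
  closure_convexHull_extremePoints (isCompact_traceSpace hu) (convex_traceSpace u)

/-- A lower bound for an element on the pure traces holds on all normalized traces. -/
theorem le_of_forall_pure_le {u : G} (hu : IsOrderUnit u) {a : G} {δ : ℝ}
    (h : ∀ f ∈ pureTraceSpace u, δ ≤ f a) {f : G → ℝ} (hf : f ∈ traceSpace u) : δ ≤ f a := by
  rw [← closure_convexHull_pureTraceSpace hu] at hf
  have hcl : IsClosed {f : G → ℝ | δ ≤ f a} := isClosed_le (by fun_prop) (by fun_prop)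
  have hconv : Convex ℝ {f : G → ℝ | δ ≤ f a} :=
    convex_halfSpace_ge (f := fun f : G → ℝ => f a) ⟨fun _ _ => rfl, fun _ _ => rfl⟩ δ
  exact closure_minimal (convexHull_min h hconv) hcl hf

end TraceSpace

/-! ### The lattice cone over the trace space -/

section Lattice

variable {G : Type*} [AddCommGroup G] [PartialOrder G] [IsOrderedAddMonoid G]

/-- A function additive on the positive cone of a directed group extends to a homomorphism. -/
theorem exists_hom_of_additive_on_nonneg
    (hdir : ∀ g : G, ∃ a b : G, 0 ≤ a ∧ 0 ≤ b ∧ g = a - b) {z : G → ℝ}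
    (hz : ∀ a b, 0 ≤ a → 0 ≤ b → z (a + b) = z a + z b) :
    ∃ h : G →+ ℝ, ∀ a, 0 ≤ a → h a = z a := by
  choose p n hp hn hpn using hdir
  have key : ∀ a b c d : G, 0 ≤ a → 0 ≤ b → 0 ≤ c → 0 ≤ d → a - b = c - d →
      z a - z b = z c - z d := by
    intro a b c d ha hb hc hd h
    have h' : a + d = c + b := by rwa [sub_eq_sub_iff_add_eq_add] at h
    have := congrArg z h'
    rw [hz a d ha hd, hz c b hc hb] at this
    linarith
  have h0 : z 0 = 0 := by simpa using hz 0 0 le_rfl le_rfl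
  refine ⟨AddMonoidHom.mk' (fun g => z (p g) - z (n g)) fun g g' => ?_, fun a ha => ?_⟩
  · have := key (p (g + g')) (n (g + g')) (p g + p g') (n g + n g') (hp _) (hn _)
      (add_nonneg (hp _) (hp _)) (add_nonneg (hn _) (hn _)) (by
        rw [← hpn, add_sub_add_comm, ← hpn, ← hpn])
    rw [this, hz _ _ (hp _) (hp _), hz _ _ (hn _) (hn _)]
    ring
  · have := key (p a) (n a) a 0 (hp _) (hn _) ha le_rfl (by rw [← hpn, sub_zero])
    simpa [h0] using this

/-- The Riesz–Kantorovich theorem: two positive homomorphisms on a directed group with Riesz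
decomposition have a least upper bound. -/
theorem exists_sup_hom (hG : IsDimensionGroup G) {f g : G →+ ℝ}
    (hf : ∀ a, 0 ≤ a → 0 ≤ f a) (hg : ∀ a, 0 ≤ a → 0 ≤ g a) :
    ∃ h : G →+ ℝ, (∀ a, 0 ≤ a → f a ≤ h a) ∧ (∀ a, 0 ≤ a → g a ≤ h a) ∧
      ∀ w : G →+ ℝ, (∀ a, 0 ≤ a → f a ≤ w a) → (∀ a, 0 ≤ a → g a ≤ w a) →
        ∀ a, 0 ≤ a → h a ≤ w a := by
  let R : G → Set ℝ := fun a => {r | ∃ c, 0 ≤ c ∧ c ≤ a ∧ r = f c + g (a - c)}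
  have hub : ∀ w : G →+ ℝ, (∀ a, 0 ≤ a → f a ≤ w a) → (∀ a, 0 ≤ a → g a ≤ w a) →
      ∀ a, ∀ r ∈ R a, r ≤ w a := by
    rintro w h₁ h₂ a _ ⟨c, hc, hca, rfl⟩
    have := h₁ c hc
    have := h₂ (a - c) (sub_nonneg.2 hca)
    rw [map_sub] at this ⊢
    rw [map_sub] at this
    linarith
  have hbdd : ∀ a, BddAbove (R a) := fun a => ⟨(f + g) a, hub (f + g)
    (fun a ha => by simpa using hg a ha) (fun a ha => by simpa using hf a ha) a⟩
  have hmem_f : ∀ a, 0 ≤ a → f a ∈ R a := fun a ha => ⟨a, ha, le_rfl, by simp⟩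
  have hmem_g : ∀ a, 0 ≤ a → g a ∈ R a := fun a ha => ⟨0, le_rfl, ha, by simp⟩
  obtain ⟨h, hh⟩ := exists_hom_of_additive_on_nonneg hG.directed (z := fun a => sSup (R a)) (by
    intro a b ha hb
    refine le_antisymm (csSup_le ⟨_, hmem_f _ (add_nonneg ha hb)⟩ ?_) ?_
    · rintro _ ⟨c, hc, hcab, rfl⟩
      -- Riesz decomposition is exactly what makes the Kantorovich supremum subadditive.
      obtain ⟨c₁, c₂, h₁, h₁a, h₂, h₂b, rfl⟩ := hG.riesz c a b hc ha hb hcab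
      have h₃ : f c₁ + g (a - c₁) ≤ sSup (R a) := le_csSup (hbdd a) ⟨c₁, h₁, h₁a, rfl⟩
      have h₄ : f c₂ + g (b - c₂) ≤ sSup (R b) := le_csSup (hbdd b) ⟨c₂, h₂, h₂b, rfl⟩
      simp only [map_sub, map_add] at h₃ h₄ ⊢
      linarith
    · rw [← le_sub_iff_add_le]
      refine csSup_le ⟨_, hmem_f _ ha⟩ ?_
      rintro _ ⟨c, hc, hca, rfl⟩
      rw [le_sub_iff_add_le, ← le_sub_iff_add_le']
      refine csSup_le ⟨_, hmem_f _ hb⟩ ?_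
      rintro _ ⟨d, hd, hdb, rfl⟩
      rw [le_sub_iff_add_le']
      refine le_csSup (hbdd _) ⟨c + d, add_nonneg hc hd, add_le_add hca hdb, ?_⟩
      simp only [map_sub, map_add]
      ring)
  refine ⟨h, fun a ha => ?_, fun a ha => ?_, fun w h₁ h₂ a ha => ?_⟩
  · rw [hh a ha]; exact le_csSup (hbdd a) (hmem_f a ha)
  · rw [hh a ha]; exact le_csSup (hbdd a) (hmem_g a ha)
  · rw [hh a ha]; exact csSup_le ⟨_, hmem_f a ha⟩ (hub w h₁ h₂ a)

/-- A positive homomorphism is determined up to scale by a normalized trace, since it vanishes once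
it kills the order unit. This replaces the cone by positive homomorphisms, where suprema are
available. Nonemptiness is needed for the apex. -/
theorem mem_coneOver_traceSpace_iff {u : G} (hu : IsOrderUnit u) (hne : (traceSpace u).Nonempty)
    {p : (G → ℝ) × ℝ} :
    p ∈ coneOver (traceSpace u) ↔
      ∃ ρ : G →+ ℝ, (∀ a, 0 ≤ a → 0 ≤ ρ a) ∧ p = (⇑ρ, ρ u) := by
  constructor
  · rintro ⟨t, ht, _, ⟨τ, hτ, rfl⟩, rfl⟩
    obtain ⟨h₁, h₂⟩ := isNormalizedTrace_iff.1 hτ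
    refine ⟨t • τ, fun a ha => mul_nonneg ht (h₁ a ha), ?_⟩
    ext <;> simp [h₂]
  · rintro ⟨ρ, hρ, rfl⟩
    rcases (hρ u hu.1).eq_or_lt with h0 | hpos
    · obtain ⟨f, hf⟩ := hne
      refine ⟨0, le_rfl, f, hf, ?_⟩
      have : ∀ g, ρ g = 0 := by
        intro g
        obtain ⟨N, -, h₁, h₂⟩ := hu.2 g
        have h₃ := map_le_of_nonneg hρ h₁
        have h₄ := map_le_of_nonneg hρ h₂
        simp only [map_neg, map_nsmul, ← h0, smul_zero, neg_zero] at h₃ h₄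
        exact le_antisymm h₄ h₃
      ext <;> simp [this]
    · refine ⟨ρ u, hpos.le, ⇑((ρ u)⁻¹ • ρ), coe_mem_traceSpace.2 (isNormalizedTrace_iff.2
        ⟨fun a ha => mul_nonneg (inv_nonneg.2 hpos.le) (hρ a ha), ?_⟩), ?_⟩
      · simp [hpos.ne']
      · ext <;> simp [hpos.ne']

theorem isLatticeCone_traceSpace {u : G} (hu : IsOrderUnit u) (hG : IsDimensionGroup G) :
    IsLatticeCone (coneOver (traceSpace u)) := by
  rcases (traceSpace u).eq_empty_or_nonempty with he | hne
  · rintro x ⟨t, -, y, hy, -⟩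
    simp [he] at hy
  have hmem := fun p => mem_coneOver_traceSpace_iff hu hne (p := p)
  have hsub : ∀ ρ ρ' : G →+ ℝ, ((⇑ρ, ρ u) : (G → ℝ) × ℝ) - (⇑ρ', ρ' u) ∈ coneOver (traceSpace u) ↔
      ∀ a, 0 ≤ a → ρ' a ≤ ρ a := by
    intro ρ ρ'
    rw [hmem]
    constructor
    · rintro ⟨σ, hσ, h⟩ a ha
      have h' := congrFun (congrArg Prod.fst h) a
      simp only [Prod.fst_sub, Pi.sub_apply] at h'
      linarith [hσ a ha]
    · intro h
      exact ⟨ρ - ρ', fun a ha => sub_nonneg.2 (h a ha), by ext <;> simp⟩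
  intro x hx y hy
  obtain ⟨f, hf, rfl⟩ := (hmem x).1 hx
  obtain ⟨g, hg, rfl⟩ := (hmem y).1 hy
  obtain ⟨h, h₁, h₂, h₃⟩ := exists_sup_hom hG hf hg
  refine ⟨(⇑h, h u), (hmem _).2 ⟨h, fun a ha => (hf a ha).trans (h₁ a ha), rfl⟩,
    (hsub _ _).2 h₁, (hsub _ _).2 h₂, ?_⟩
  intro w hw hwf hwg
  obtain ⟨w, -, rfl⟩ := (hmem w).1 hw
  rw [hsub] at hwf hwg ⊢
  exact h₃ w hwf hwg

theorem isChoquetSimplex_traceSpace {u : G} (hu : IsOrderUnit u) (hG : IsDimensionGroup G) :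
    IsChoquetSimplex (traceSpace u) :=
  ⟨isCompact_traceSpace hu, convex_traceSpace u, isLatticeCone_traceSpace hu hG⟩

end Lattice

end DimGroup

namespace DimGroup

open Set Filter Topology

/-! ### Affine functions and their restriction to extreme points -/

section AffineFunctions

variable {E : Type*} [AddCommGroup E] [Module ℝ E] [TopologicalSpace E]

theorem const_mem_Aff (K : Set E) (c : ℝ) : ContinuousMap.const K c ∈ Aff K := by
  intro x y z a b _ _ hab _
  simp [← add_mul, hab]

theorem isClosed_Aff (K : Set E) : IsClosed (Aff K : Set C(K, ℝ)) := by
  have : (Aff K : Set C(K, ℝ)) = ⋂ (x : K) (y : K) (z : K) (a : ℝ) (b : ℝ) (_ : 0 ≤ a) (_ : 0 ≤ b)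
      (_ : a + b = 1) (_ : (z : E) = a • (x : E) + b • (y : E)),
      {f : C(K, ℝ) | f z = a * f x + b * f y} := by
    ext f
    simp only [mem_iInter]
    rfl
  rw [this]
  repeat' refine isClosed_iInter fun _ => ?_
  exact isClosed_eq (by fun_prop) (by fun_prop)

/-- Restriction of continuous affine functions to the extreme points. -/
def restrictExtremePoints (K : Set E) : Aff K →ₗ[ℝ] C(K.extremePoints ℝ, ℝ) :=
  (ContinuousMap.compRightAlgHom ℝ ℝ
    (⟨Set.inclusion extremePoints_subset, continuous_inclusion extremePoints_subset⟩ :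
      C(K.extremePoints ℝ, K))).toLinearMap ∘ₗ (Aff K).subtype

variable [T2Space E] [IsTopologicalAddGroup E] [ContinuousSMul ℝ E] [LocallyConvexSpace ℝ E]

/-- A continuous affine function which is nonnegative on the extreme points is nonnegative. -/
theorem nonneg_of_nonneg_on_extremePoints {K : Set E} (hK : IsCompact K) (hconv : Convex ℝ K)
    {f : C(K, ℝ)} (hf : f ∈ Aff K)
    (h : ∀ x (hx : x ∈ K.extremePoints ℝ), 0 ≤ f ⟨x, extremePoints_subset hx⟩) : 0 ≤ f := by
  have hcl : IsClosed (Subtype.val '' {x : K | 0 ≤ f x}) :=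
    hK.isClosed.isClosedEmbedding_subtypeVal.isClosedMap _
      (isClosed_le (by fun_prop) (by fun_prop))
  have hcv : Convex ℝ (Subtype.val '' {x : K | 0 ≤ f x}) := by
    rintro _ ⟨x, hx, rfl⟩ _ ⟨y, hy, rfl⟩ a b ha hb hab
    refine ⟨⟨a • (x : E) + b • (y : E), hconv x.2 y.2 ha hb hab⟩, ?_, rfl⟩
    rw [mem_ofPred_eq] at *
    rw [hf x y _ a b ha hb hab rfl]
    positivity
  intro x
  have hx : (x : E) ∈ closure (convexHull ℝ (K.extremePoints ℝ)) := by
    rw [closure_convexHull_extremePoints hK hconv]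
    exact x.2
  have hext : K.extremePoints ℝ ⊆ Subtype.val '' {x : K | 0 ≤ f x} :=
    fun x hx => ⟨⟨x, extremePoints_subset hx⟩, h x hx, rfl⟩
  obtain ⟨y, hy, hyx⟩ := closure_minimal (convexHull_min hext hcv) hcl hx
  rw [← Subtype.ext hyx]
  exact hy

theorem restrictExtremePoints_nonneg_iff {K : Set E} (hK : IsCompact K) (hconv : Convex ℝ K)
    (f : Aff K) : 0 ≤ restrictExtremePoints K f ↔ 0 ≤ (f : C(K, ℝ)) :=
  ⟨fun h => nonneg_of_nonneg_on_extremePoints hK hconv f.2 fun x hx => h ⟨x, hx⟩,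
    fun h x => h ⟨x.1, extremePoints_subset x.2⟩⟩

theorem norm_restrictExtremePoints {K : Set E} [CompactSpace K] [CompactSpace (K.extremePoints ℝ)]
    (hconv : Convex ℝ K) (f : Aff K) : ‖restrictExtremePoints K f‖ = ‖f‖ := by
  have hK : IsCompact K := isCompact_iff_compactSpace.2 ‹_›
  change _ = ‖(f : C(K, ℝ))‖
  refine le_antisymm ((ContinuousMap.norm_le _ (norm_nonneg _)).2 fun x =>
    (f : C(K, ℝ)).norm_coe_le_norm _) ?_
  have hle := fun x => (restrictExtremePoints K f).norm_coe_le_norm x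
  simp only [Real.norm_eq_abs, abs_le] at hle
  have h₁ := nonneg_of_nonneg_on_extremePoints hK hconv
    ((Aff K).sub_mem (const_mem_Aff K ‖restrictExtremePoints K f‖) f.2)
    fun x hx => sub_nonneg.2 (hle ⟨x, hx⟩).2
  have h₂ := nonneg_of_nonneg_on_extremePoints hK hconv
    ((Aff K).add_mem (const_mem_Aff K ‖restrictExtremePoints K f‖) f.2)
    fun x hx => neg_le_iff_add_nonneg'.1 (hle ⟨x, hx⟩).1
  refine (ContinuousMap.norm_le _ (norm_nonneg _)).2 fun x => ?_
  rw [Real.norm_eq_abs, abs_le]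
  exact ⟨neg_le_iff_add_nonneg'.2 (h₂ x), sub_nonneg.1 (h₁ x)⟩

/-- Restriction to the extreme points as an isometry. -/
noncomputable def restrictExtremePointsIsometry (K : Set E) [CompactSpace K]
    [CompactSpace (K.extremePoints ℝ)] (hconv : Convex ℝ K) :
    Aff K →ₗᵢ[ℝ] C(K.extremePoints ℝ, ℝ) :=
  ⟨restrictExtremePoints K, norm_restrictExtremePoints hconv⟩

theorem isClosed_range_restrictExtremePoints {K : Set E} [CompactSpace K]
    [CompactSpace (K.extremePoints ℝ)] (hconv : Convex ℝ K) :
    IsClosed (Set.range (restrictExtremePoints K)) := by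
  have : CompleteSpace (Aff K) := (isClosed_Aff K).completeSpace_coe
  exact (restrictExtremePointsIsometry K hconv).isometry.isClosedEmbedding.isClosed_range

/-- If the restrictions of continuous affine functions to the extreme points include a
multiplicative monoid that separates points, then every continuous function on the extreme points
is such a restriction. -/
theorem restrictExtremePoints_surjective {K : Set E} [CompactSpace K]
    [CompactSpace (K.extremePoints ℝ)] (hconv : Convex ℝ K)
    (M : Submonoid C(K.extremePoints ℝ, ℝ))
    (hM : ∀ g ∈ M, g ∈ LinearMap.range (restrictExtremePoints K))
    (hsep : ∀ x y : K.extremePoints ℝ, x ≠ y → ∃ g ∈ M, g x ≠ g y) :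
    Function.Surjective (restrictExtremePoints K) := by
  -- As `M` is closed under products, the algebra it generates is just its linear span.
  have hB : (Algebra.adjoin ℝ (M : Set C(K.extremePoints ℝ, ℝ)) : Set C(K.extremePoints ℝ, ℝ)) ⊆
      Set.range (restrictExtremePoints K) := by
    have h : Subalgebra.toSubmodule (Algebra.adjoin ℝ (M : Set C(K.extremePoints ℝ, ℝ))) ≤
        LinearMap.range (restrictExtremePoints K) := by
      rw [Algebra.adjoin_eq_span, Submonoid.closure_eq, Submodule.span_le]
      exact hM
    exact h
  have htop := ContinuousMap.subalgebra_topologicalClosure_eq_top_of_separatesPoints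
    (Algebra.adjoin ℝ (M : Set C(K.extremePoints ℝ, ℝ))) fun x y hxy => by
      obtain ⟨g, hg, hne⟩ := hsep x y hxy
      exact ⟨_, ⟨g, Algebra.subset_adjoin hg, rfl⟩, hne⟩
  intro f
  have hf : f ∈ (Algebra.adjoin ℝ (M : Set C(K.extremePoints ℝ, ℝ))).topologicalClosure :=
    htop ▸ Algebra.mem_top
  exact closure_minimal hB (isClosed_range_restrictExtremePoints hconv) hf

end AffineFunctions

/-! ### Pure traces of a partially ordered ring -/

section Ring

variable {A : Type*} [Ring A] [PartialOrder A] [IsOrderedRing A]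

/-- For `0 ≤ a ≤ N • 1`, the homomorphism `x ↦ τ (a * x)` is positive and at most `N τ`, hence
proportional to `τ` by purity. A general `a` is shifted into the positive cone by a multiple of `1`.
-/
theorem IsPureTrace.map_mul (hunit : IsOrderUnit (1 : A)) {τ : A →+ ℝ}
    (hτ : IsPureTrace (1 : A) τ) (a b : A) : τ (a * b) = τ a * τ b := by
  obtain ⟨hpos, hone⟩ := isNormalizedTrace_iff.1 hτ.isNormalizedTrace
  have key : ∀ a : A, 0 ≤ a → τ (a * b) = τ a * τ b := by
    intro a ha
    obtain ⟨N, -, -, hN⟩ := hunit.2 a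
    have := hτ.eq_smul_of_le hunit.1 (ρ := τ.comp (AddMonoidHom.mulLeft a)) (N := N)
      (fun x hx => hpos _ (mul_nonneg ha hx)) (fun x hx => by
        have h := map_le_of_nonneg hpos (mul_le_mul_of_nonneg_right hN hx)
        rwa [smul_mul_assoc, one_mul, map_nsmul, nsmul_eq_mul] at h) b
    simpa using this
  obtain ⟨N, -, hN, -⟩ := hunit.2 a
  have h := key (a + N • 1) (neg_le_iff_add_nonneg.1 hN)
  simp only [add_mul, smul_mul_assoc, one_mul, map_add, map_nsmul, hone] at h
  linarith

theorem mul_of_mem_pureTraceSpace (hunit : IsOrderUnit (1 : A)) {f : A → ℝ}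
    (hf : f ∈ pureTraceSpace (1 : A)) (a b : A) : f (a * b) = f a * f b := by
  obtain ⟨τ, hτ, rfl⟩ := extremePoints_subset hf
  exact IsPureTrace.map_mul hunit hf a b

/-- Every normalized trace satisfies the Cauchy–Schwarz inequality `f a ^ 2 ≤ f (a * a)`. -/
theorem sq_le_of_mem_traceSpace (hunit : IsOrderUnit (1 : A)) {f : A → ℝ}
    (hf : f ∈ traceSpace (1 : A)) (a : A) : f a ^ 2 ≤ f (a * a) := by
  rw [← closure_convexHull_pureTraceSpace hunit] at hf
  have hcl : IsClosed {f : A → ℝ | f a ^ 2 ≤ f (a * a)} := isClosed_le (by fun_prop) (by fun_prop)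
  have hconv : Convex ℝ {f : A → ℝ | f a ^ 2 ≤ f (a * a)} := by
    intro f hf g hg s t hs ht hst
    simp only [mem_ofPred_eq, Pi.add_apply, Pi.smul_apply, smul_eq_mul] at *
    obtain rfl : t = 1 - s := by linarith
    nlinarith [mul_le_mul_of_nonneg_left hf hs, mul_le_mul_of_nonneg_left hg ht,
      mul_nonneg (mul_nonneg hs ht) (sq_nonneg (f a - g a))]
  refine closure_minimal (convexHull_min ?_ hconv) hcl hf
  intro g hg
  rw [mem_ofPred_eq, mul_of_mem_pureTraceSpace hunit hg, sq]

theorem mem_pureTraceSpace_iff (hunit : IsOrderUnit (1 : A)) {f : A → ℝ} :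
    f ∈ pureTraceSpace (1 : A) ↔ f ∈ traceSpace (1 : A) ∧ ∀ a b, f (a * b) = f a * f b := by
  refine ⟨fun h => ⟨extremePoints_subset h, mul_of_mem_pureTraceSpace hunit h⟩, ?_⟩
  rintro ⟨hf, hmul⟩
  refine ⟨hf, fun g hg g' hg' ⟨s, t, hs, ht, hst, hfs⟩ => ?_⟩
  ext a
  have h₁ := congrFun hfs a
  have h₂ := congrFun hfs (a * a)
  rw [hmul] at h₂
  simp only [Pi.add_apply, Pi.smul_apply, smul_eq_mul] at h₁ h₂
  have h₃ := mul_le_mul_of_nonneg_left (sq_le_of_mem_traceSpace hunit hg a) hs.le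
  have h₄ := mul_le_mul_of_nonneg_left (sq_le_of_mem_traceSpace hunit hg' a) ht.le
  obtain rfl : t = 1 - s := by linarith
  -- The left side is `s (g a)² + t (g' a)² - (f a)²`, and the two Cauchy–Schwarz bounds give at
  -- most `f (a * a) - (f a)² = 0`.
  have h₅ : s * (1 - s) * (g a - g' a) ^ 2 ≤ 0 := by
    rw [← h₁] at h₂
    nlinarith
  have h₆ : g a - g' a = 0 := by
    have : 0 < s * (1 - s) := mul_pos hs ht
    have : (g a - g' a) ^ 2 ≤ 0 := by
      by_contra! hcon
      nlinarith [mul_pos this hcon]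
    exact pow_eq_zero_iff two_ne_zero |>.1 (le_antisymm this (sq_nonneg _))
  rw [← h₁, sub_eq_zero.1 h₆]
  ring

theorem isClosed_pureTraceSpace (hunit : IsOrderUnit (1 : A)) :
    IsClosed (pureTraceSpace (1 : A)) := by
  have : pureTraceSpace (1 : A) = traceSpace (1 : A) ∩
      ⋂ (a : A) (b : A), {f : A → ℝ | f (a * b) = f a * f b} := by
    ext f
    simp [mem_pureTraceSpace_iff hunit]
  rw [this]
  exact (isClosed_traceSpace 1).inter
    (isClosed_iInter fun a => isClosed_iInter fun b => isClosed_eq (by fun_prop) (by fun_prop))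

theorem isCompact_pureTraceSpace (hunit : IsOrderUnit (1 : A)) :
    IsCompact (pureTraceSpace (1 : A)) :=
  (isCompact_traceSpace hunit).of_isClosed_subset (isClosed_pureTraceSpace hunit)
    extremePoints_subset

theorem isBauerSimplex_traceSpace (hunit : IsOrderUnit (1 : A)) (hdim : IsDimensionGroup A) :
    IsBauerSimplex (traceSpace (1 : A)) :=
  ⟨isChoquetSimplex_traceSpace hunit hdim, isClosed_pureTraceSpace hunit⟩

/-- Evaluation of the elements of the ring on the space of pure traces. -/
def pureEval (hunit : IsOrderUnit (1 : A)) : A →+* C(pureTraceSpace (1 : A), ℝ) where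
  toFun a := ⟨fun f => f.1 a, (continuous_apply a).comp continuous_subtype_val⟩
  map_one' := by
    ext f
    exact (mem_traceSpace_iff.1 (extremePoints_subset f.2)).2.2
  map_mul' a b := by
    ext f
    exact mul_of_mem_pureTraceSpace hunit f.2 a b
  map_zero' := by
    ext f
    have := (mem_traceSpace_iff.1 (extremePoints_subset f.2)).1 0 0
    simpa using this
  map_add' a b := by
    ext f
    exact (mem_traceSpace_iff.1 (extremePoints_subset f.2)).1 a b

@[simp]
theorem pureEval_apply (hunit : IsOrderUnit (1 : A)) (a : A) (f : pureTraceSpace (1 : A)) :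
    pureEval hunit a f = f.1 a := rfl

theorem pureEval_nonneg (hunit : IsOrderUnit (1 : A)) {a : A} (ha : 0 ≤ a)
    (f : pureTraceSpace (1 : A)) : 0 ≤ pureEval hunit a f :=
  (mem_traceSpace_iff.1 (extremePoints_subset f.2)).2.1 a ha

theorem pureEval_mono (hunit : IsOrderUnit (1 : A)) {a b : A} (h : a ≤ b)
    (f : pureTraceSpace (1 : A)) : pureEval hunit a f ≤ pureEval hunit b f := by
  have := pureEval_nonneg hunit (sub_nonneg.2 h) f
  simpa using this

theorem pureEval_mem_range_restrict (hunit : IsOrderUnit (1 : A)) (a : A) :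
    pureEval hunit a ∈ LinearMap.range (restrictExtremePoints (traceSpace (1 : A))) := by
  refine ⟨⟨⟨fun f => f.1 a, (continuous_apply a).comp continuous_subtype_val⟩, ?_⟩, rfl⟩
  intro x y z s t _ _ _ hz
  simpa using congrFun hz a

theorem restrictExtremePoints_traceSpace_surjective (hunit : IsOrderUnit (1 : A)) :
    Function.Surjective (restrictExtremePoints (traceSpace (1 : A))) := by
  have : CompactSpace (traceSpace (1 : A)) :=
    isCompact_iff_compactSpace.1 (isCompact_traceSpace hunit)
  have : CompactSpace ((traceSpace (1 : A)).extremePoints ℝ) :=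
    isCompact_iff_compactSpace.1 (isCompact_pureTraceSpace hunit)
  refine restrictExtremePoints_surjective (convex_traceSpace 1)
    (MonoidHom.mrange (pureEval hunit)) ?_ fun f g hfg => ?_
  · rintro _ ⟨a, rfl⟩
    exact pureEval_mem_range_restrict hunit a
  · obtain ⟨a, ha⟩ := Function.ne_iff.1 (fun h => hfg (Subtype.ext h))
    exact ⟨_, ⟨a, rfl⟩, ha⟩

/-- An element which is positive on the pure traces is positive. -/
theorem nonneg_of_pureEval_pos (hunit : IsOrderUnit (1 : A)) (hdim : IsDimensionGroup A) {a : A}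
    (ha : ∀ f, 0 < pureEval hunit a f) : 0 ≤ a := by
  have hc := isCompact_pureTraceSpace hunit
  obtain ⟨δ, hδ, h⟩ : ∃ δ : ℝ, 0 < δ ∧ ∀ f ∈ pureTraceSpace (1 : A), δ ≤ f a := by
    rcases (pureTraceSpace (1 : A)).eq_empty_or_nonempty with he | hne
    · exact ⟨1, one_pos, by simp [he]⟩
    · obtain ⟨f, hf, hmin⟩ := hc.exists_isMinOn hne
        (f := fun f : A → ℝ => f a) (by fun_prop)
      exact ⟨f a, ha ⟨f, hf⟩, fun g hg => hmin hg⟩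
  exact nonneg_of_forall_trace_pos hunit hdim.unperforated fun τ hτ =>
    hδ.trans_le (le_of_forall_pure_le hunit h (coe_mem_traceSpace.2 hτ))

/-- A pure trace whose image is not cyclic takes a value strictly between `0` and `1` on the unit
interval. -/
theorem exists_mem_unitInterval (hunit : IsOrderUnit (1 : A)) (hdim : IsDimensionGroup A)
    {τ : A →+ ℝ} (hτ : IsNormalizedTrace (1 : A) τ) (hcyc : ¬ IsAddCyclic τ.range) :
    ∃ y : A, 0 ≤ y ∧ y ≤ 1 ∧ 0 < τ y ∧ τ y < 1 := by
  obtain ⟨hpos, hone⟩ := isNormalizedTrace_iff.1 hτ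
  by_contra! hcon
  have hunitInt : ∀ y : A, 0 ≤ y → y ≤ 1 → τ y ∈ AddSubgroup.zmultiples (1 : ℝ) := by
    intro y h₀ h₁
    rcases (hpos y h₀).eq_or_lt with h | h
    · rw [← h]; exact zero_mem _
    · have := map_le_of_nonneg hpos h₁
      rw [hone] at this
      rw [le_antisymm this (hcon y h₀ h₁ h)]
      exact AddSubgroup.mem_zmultiples _
  -- Riesz decomposition cuts an element of `[0, N]` into `N` elements of `[0, 1]`, where `τ` takes
  -- only the values `0` and `1`.
  have hint : ∀ (N : ℕ) (x : A), 0 ≤ x → x ≤ N • 1 → τ x ∈ AddSubgroup.zmultiples (1 : ℝ) := by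
    intro N
    induction N with
    | zero =>
      intro x h₀ h₁
      rw [le_antisymm (by simpa using h₁) h₀, map_zero]
      exact zero_mem _
    | succ N ih =>
      intro x h₀ h₁
      rw [succ_nsmul] at h₁
      obtain ⟨b, c, hb, hbN, hc, hc1, rfl⟩ :=
        hdim.riesz x (N • 1) 1 h₀ (nsmul_nonneg hunit.1 N) hunit.1 h₁
      rw [map_add]
      exact add_mem (ih b hb hbN) (hunitInt c hc hc1)
  refine hcyc ((AddSubgroup.isAddCyclic_iff_exists_zmultiples_eq_top _).2 ⟨1, le_antisymm ?_ ?_⟩)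
  · rw [AddSubgroup.zmultiples_le]
    exact ⟨1, hone⟩
  · rintro _ ⟨x, rfl⟩
    obtain ⟨a, b, ha, hb, rfl⟩ := hdim.directed x
    obtain ⟨N, -, -, hN⟩ := hunit.2 a
    obtain ⟨M, -, -, hM⟩ := hunit.2 b
    rw [map_sub]
    exact sub_mem (hint N a ha hN) (hint M b hb hM)

/-! ### Real constants as limits of evaluations -/

/-- There is `e = 1 - 2 d` in the unit interval which is less than `1` on all pure traces. -/
theorem exists_one_sub_two_mul (hunit : IsOrderUnit (1 : A)) (hdim : IsDimensionGroup A)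
    (hdiv : IsApproximatelyDivisible (1 : A)) :
    ∃ d : A, 0 ≤ 1 - 2 * d ∧ ∀ f, pureEval hunit (1 - 2 * d) f < 1 := by
  have : CompactSpace (pureTraceSpace (1 : A)) :=
    isCompact_iff_compactSpace.1 (isCompact_pureTraceSpace hunit)
  obtain ⟨d, h₀, -, h⟩ := isCompact_univ.induction_on
    (p := fun s : Set (pureTraceSpace (1 : A)) => ∃ d : A, 0 ≤ 1 - 2 * d ∧ 1 - 2 * d ≤ 1 ∧
      ∀ f ∈ s, pureEval hunit (1 - 2 * d) f < 1) ⟨0, by simp, by simp, by simp⟩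
    (fun s t hst ⟨d, h₀, h₁, h⟩ => ⟨d, h₀, h₁, fun f hf => h f (hst hf)⟩) (by
      rintro s t ⟨d, h₀, h₁, h⟩ ⟨d', h₀', h₁', h'⟩
      -- Elements of the form `1 - 2 d` are closed under products, so finitely many local solutions
      -- multiply to a global one.
      have heq : 1 - 2 * (d + d' - 2 * d * d') = (1 - 2 * d) * (1 - 2 * d') := by noncomm_ring
      refine ⟨d + d' - 2 * d * d', ?_, ?_, fun f hf => ?_⟩
      · rw [heq]; exact mul_nonneg h₀ h₀'
      · rw [heq]; exact mul_le_one₀ h₁ h₀' h₁'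
      · rw [heq, _root_.map_mul, ContinuousMap.mul_apply]
        have e₀ := pureEval_nonneg hunit h₀ f
        have e₀' := pureEval_nonneg hunit h₀' f
        have e₁ := pureEval_mono hunit h₁ f
        have e₁' := pureEval_mono hunit h₁' f
        rw [map_one, ContinuousMap.one_apply] at e₁ e₁'
        rcases hf with hf | hf
        · nlinarith [h f hf]
        · nlinarith [h' f hf]) (by
      intro f _
      obtain ⟨τ, hτ, hfτ⟩ := extremePoints_subset f.2
      have hpure : IsPureTrace (1 : A) τ := by
        rw [IsPureTrace, ← hfτ]; exact f.2
      obtain ⟨y, hy₀, hy₁, hlt₀, hlt₁⟩ := exists_mem_unitInterval hunit hdim hτ (hdiv τ hpure)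
      have hy₁' := sub_nonneg.2 hy₁
      have heq : 1 - 2 * (y * (1 - y)) = y * y + (1 - y) * (1 - y) := by noncomm_ring
      have hlt : pureEval hunit (1 - 2 * (y * (1 - y))) f < 1 := by
        rw [heq]
        simp only [map_add, _root_.map_mul, map_sub, map_one, ContinuousMap.add_apply,
          ContinuousMap.mul_apply, ContinuousMap.sub_apply, ContinuousMap.one_apply,
          pureEval_apply, hfτ]
        nlinarith
      refine ⟨{g | pureEval hunit (1 - 2 * (y * (1 - y))) g < 1}, ?_, y * (1 - y), ?_, ?_,
        fun g hg => hg⟩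
      · rw [nhdsWithin_univ]
        exact (isOpen_lt (by fun_prop) (by fun_prop)).mem_nhds hlt
      · rw [heq]; exact add_nonneg (mul_nonneg hy₀ hy₀) (mul_nonneg hy₁' hy₁')
      · have := mul_nonneg hy₀ hy₁'
        rw [two_mul, sub_le_self_iff]
        exact add_nonneg this this)
  exact ⟨d, h₀, fun f => h f (mem_univ f)⟩

/-- The constant functions lie in the closure of the evaluations. -/
theorem const_mem_closure_range_pureEval
    [CompactSpace (pureTraceSpace (1 : A))] (hunit : IsOrderUnit (1 : A)) (hdim : IsDimensionGroup A)
    (hdiv : IsApproximatelyDivisible (1 : A)) (r : ℝ) :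
    algebraMap ℝ C(pureTraceSpace (1 : A), ℝ) r ∈ (pureEval hunit).range.topologicalClosure := by
  set R := (pureEval hunit).range.topologicalClosure
  have hhalf : algebraMap ℝ C(pureTraceSpace (1 : A), ℝ) (1 / 2) ∈ R := by
    obtain ⟨d, h₀, h₁⟩ := exists_one_sub_two_mul hunit hdim hdiv
    have hnorm : ‖pureEval hunit (1 - 2 * d)‖ < 1 := by
      refine (ContinuousMap.norm_lt_iff _ one_pos).2 fun f => ?_
      rw [Real.norm_eq_abs, abs_of_nonneg (pureEval_nonneg hunit h₀ f)]
      exact h₁ f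
    -- The powers tend uniformly to `0` on `X`, so the evaluations of these `c` tend to `1 / 2`.
    have hpow : ∀ n : ℕ, ∃ c : A, (1 - 2 * d) ^ n = 1 - 2 * c := by
      intro n
      induction n with
      | zero => exact ⟨0, by simp⟩
      | succ n ih =>
        obtain ⟨c, hc⟩ := ih
        exact ⟨c + d - 2 * c * d, by rw [pow_succ, hc]; noncomm_ring⟩
    choose c hc using hpow
    have hlim : Tendsto (fun n => pureEval hunit (c n)) atTop
        (𝓝 ((1 / 2 : ℝ) • (1 - 0))) := by
      have := (tendsto_pow_atTop_nhds_zero_of_norm_lt_one hnorm).const_sub 1 |>.const_smul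
        (1 / 2 : ℝ)
      refine this.congr fun n => ?_
      rw [← map_pow, hc, map_sub, map_one, sub_sub_cancel, two_mul, map_add, ← two_smul ℝ, smul_smul]
      norm_num
    rw [sub_zero, ← Algebra.algebraMap_eq_smul_one] at hlim
    exact mem_closure_of_tendsto hlim (Eventually.of_forall fun n => ⟨c n, rfl⟩)
  let D : AddSubgroup ℝ :=
    R.toAddSubgroup.comap (algebraMap ℝ C(pureTraceSpace (1 : A), ℝ)).toAddMonoidHom
  have hDc : IsClosed (D : Set ℝ) :=
    (pureEval hunit).range.isClosed_topologicalClosure.preimage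
      (continuous_algebraMap ℝ C(pureTraceSpace (1 : A), ℝ))
  have hDd : Dense (D : Set ℝ) := by
    refine D.dense_of_not_isolated_zero fun ε hε => ?_
    obtain ⟨n, hn⟩ := exists_pow_lt_of_lt_one hε (by norm_num : (1 / 2 : ℝ) < 1)
    refine ⟨(1 / 2) ^ n, ?_, by positivity, hn⟩
    change algebraMap ℝ C(pureTraceSpace (1 : A), ℝ) ((1 / 2) ^ n) ∈ R
    rw [map_pow]
    exact pow_mem hhalf n
  have : r ∈ (D : Set ℝ) := by
    rw [← hDc.closure_eq, hDd.closure_eq]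
    trivial
  exact this

/-! ### Kernels of pure traces and order unit goodness -/

/-- If no other pure trace vanishes on the kernel of the pure trace `τ`, then the kernel is dense
in the continuous functions vanishing at `τ`. -/
theorem mem_closure_map_ker [CompactSpace (pureTraceSpace (1 : A))]
    (hunit : IsOrderUnit (1 : A)) (hdim : IsDimensionGroup A)
    (hdiv : IsApproximatelyDivisible (1 : A)) {τ : A →+ ℝ} (hτ : IsPureTrace (1 : A) τ)
    (hker : ∀ σ : A →+ ℝ, IsPureTrace (1 : A) σ → τ.ker ≤ σ.ker → σ = τ)
    {f : C(pureTraceSpace (1 : A), ℝ)} (hf : f ⟨τ, hτ⟩ = 0) :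
    f ∈ (τ.ker.map (pureEval hunit).toAddMonoidHom).topologicalClosure := by
  set V := (τ.ker.map (pureEval hunit).toAddMonoidHom).topologicalClosure with hV
  have hVc : IsClosed (V : Set C(pureTraceSpace (1 : A), ℝ)) :=
    AddSubgroup.isClosed_topologicalClosure _
  have hmulR : ∀ g ∈ V, ∀ h ∈ (pureEval hunit).range.topologicalClosure, g * h ∈ V := by
    intro g hg h hh
    refine map_mem_closure₂ (f := fun g h => g * h) continuous_mul hg hh ?_
    rintro _ ⟨k, hk, rfl⟩ _ ⟨a, rfl⟩
    refine ⟨k * a, ?_, _root_.map_mul (pureEval hunit) k a⟩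
    have hk' : τ k = 0 := hk
    change τ (k * a) = 0
    rw [hτ.map_mul hunit, hk', zero_mul]
  have hVR : V ≤ (pureEval hunit).range.topologicalClosure.toAddSubgroup := by
    refine AddSubgroup.topologicalClosure_minimal _ ?_
      (pureEval hunit).range.isClosed_topologicalClosure
    rintro _ ⟨k, -, rfl⟩
    exact subset_closure ⟨k, rfl⟩
  have hmul : ∀ g ∈ V, ∀ h ∈ V, g * h ∈ V := fun g hg h hh => hmulR g hg h (hVR hh)
  have hsmul : ∀ (r : ℝ), ∀ g ∈ V, g * algebraMap ℝ _ r ∈ V := fun r g hg =>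
    hmulR g hg _ (const_mem_closure_range_pureEval hunit hdim hdiv r)
  -- Stone–Weierstrass needs a unital algebra, while functions in `V` vanish at `τ`. Subtracting the
  -- value at `τ` carries the algebra `B` into `V` and fixes `f`.
  let P : C(pureTraceSpace (1 : A), ℝ) → C(pureTraceSpace (1 : A), ℝ) :=
    fun g => g - algebraMap ℝ _ (g ⟨τ, hτ⟩)
  let B : Subalgebra ℝ C(pureTraceSpace (1 : A), ℝ) :=
    Algebra.adjoin ℝ (τ.ker.map (pureEval hunit).toAddMonoidHom)
  have hB : ∀ g ∈ B, P g ∈ V := by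
    intro g hg
    induction hg using Algebra.adjoin_induction with
    | mem g hg =>
      obtain ⟨k, hk, rfl⟩ := hg
      have hk' : τ k = 0 := hk
      have : P (pureEval hunit k) = pureEval hunit k := by simp [P, hk']
      exact this.symm ▸ subset_closure ⟨k, hk, rfl⟩
    | algebraMap r =>
      have : P (algebraMap ℝ _ r) = 0 := by simp [P]
      rw [this]
      exact zero_mem V
    | add g h _ _ hg hh =>
      have : P (g + h) = P g + P h := by
        simp only [P, ContinuousMap.add_apply, map_add]; ring
      rw [this]
      exact add_mem hg hh
    | mul g h _ _ hg hh =>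
      have : P (g * h) = P g * P h + P g * algebraMap ℝ _ (h ⟨τ, hτ⟩) +
          P h * algebraMap ℝ _ (g ⟨τ, hτ⟩) := by
        simp only [P, ContinuousMap.mul_apply, _root_.map_mul]; ring
      rw [this]
      exact add_mem (add_mem (hmul _ hg _ hh) (hsmul _ _ hg)) (hsmul _ _ hh)
  have hsepτ : ∀ g : pureTraceSpace (1 : A), g ≠ ⟨τ, hτ⟩ → ∃ k, τ k = 0 ∧ g.1 k ≠ 0 := by
    intro g hg
    obtain ⟨σ, -, hgσ⟩ := extremePoints_subset g.2
    by_contra! hcon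
    refine hg (Subtype.ext ?_)
    rw [hgσ, hker σ (by rw [IsPureTrace, ← hgσ]; exact g.2) fun k hk => ?_]
    have := hcon k hk
    rwa [hgσ] at this
  have hmem : ∀ k, τ k = 0 → pureEval hunit k ∈ B := fun k hk =>
    Algebra.subset_adjoin ⟨k, hk, rfl⟩
  have hsep : B.SeparatesPoints := by
    intro g h hgh
    suffices ∃ k, τ k = 0 ∧ g.1 k ≠ h.1 k by
      obtain ⟨k, hk, hne⟩ := this
      exact ⟨_, ⟨_, hmem k hk, rfl⟩, hne⟩
    by_cases hg : g = ⟨τ, hτ⟩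
    · obtain ⟨k, hk, hne⟩ := hsepτ h (fun hh => hgh (hg.trans hh.symm))
      refine ⟨k, hk, ?_⟩
      rw [hg]
      exact fun e => hne (e.symm.trans hk)
    · obtain ⟨k, hk, hne⟩ := hsepτ g hg
      by_cases hkk : g.1 k = h.1 k
      · obtain ⟨a, ha⟩ := Function.ne_iff.1 (fun e => hgh (Subtype.ext e))
        -- If `k` takes the same nonzero value at `g` and `h`, multiply by any `a` separating them;
        -- the product stays in the kernel.
        refine ⟨k * a, by rw [hτ.map_mul hunit, hk, zero_mul], ?_⟩
        rw [mul_of_mem_pureTraceSpace hunit g.2, mul_of_mem_pureTraceSpace hunit h.2, ← hkk]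
        exact fun e => ha (mul_left_cancel₀ hne e)
      · exact ⟨k, hk, hkk⟩
  have htop := ContinuousMap.subalgebra_topologicalClosure_eq_top_of_separatesPoints B hsep
  have hfB : f ∈ B.topologicalClosure := htop ▸ Algebra.mem_top
  have hPc : Continuous P :=
    continuous_id.sub ((continuous_algebraMap ℝ _).comp (continuous_eval_const _))
  have hBV : (B : Set C(pureTraceSpace (1 : A), ℝ)) ⊆ P ⁻¹' V := fun g hg => hB g hg
  have hPf : P f ∈ V := closure_minimal hBV (hVc.preimage hPc) hfB
  simpa [P, hf] using hPf

theorem isOrderUnitGood_of_ker (hunit : IsOrderUnit (1 : A)) (hdim : IsDimensionGroup A)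
    (hdiv : IsApproximatelyDivisible (1 : A)) {τ : A →+ ℝ} (hτ : IsPureTrace (1 : A) τ)
    (hker : ∀ σ : A →+ ℝ, IsPureTrace (1 : A) σ → τ.ker ≤ σ.ker → σ = τ) :
    IsOrderUnitGood τ := by
  have : CompactSpace (pureTraceSpace (1 : A)) :=
    isCompact_iff_compactSpace.1 (isCompact_pureTraceSpace hunit)
  obtain ⟨hpos, hone⟩ := isNormalizedTrace_iff.1 hτ.isNormalizedTrace
  intro a b ha _ hb hab
  rcases (hpos a ha).eq_or_lt with h0 | hapos
  · exact ⟨0, le_rfl, hb.1, by rw [map_zero, h0]⟩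
  obtain ⟨N, hN, -, hNb⟩ := hb.2 1
  have hN' : (0 : ℝ) < N := by exact_mod_cast hN
  have hbN : ∀ f, (N : ℝ)⁻¹ ≤ pureEval hunit b f := by
    intro f
    have := pureEval_mono hunit hNb f
    rw [map_nsmul, map_one, ContinuousMap.smul_apply, ContinuousMap.one_apply,
      nsmul_eq_mul] at this
    rwa [inv_le_iff_one_le_mul₀' hN']
  have hbpos : 0 < τ b := hapos.trans hab
  set c := τ a / τ b with hc
  have hc₀ : 0 < c := div_pos hapos hbpos
  have hc₁ : 0 < 1 - c := sub_pos.2 ((div_lt_one hbpos).2 hab)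
  have hcl := mem_closure_map_ker hunit hdim hdiv hτ hker
    (f := c • pureEval hunit b - pureEval hunit a) (by simp [hc, hbpos.ne'])
  -- Since `b` is at least `1 / N` on `X`, an error below this keeps `a + k`, which is close to `c
  -- b`, strictly between `0` and `b`.
  have hε : 0 < min c (1 - c) * (N : ℝ)⁻¹ := mul_pos (lt_min hc₀ hc₁) (inv_pos.2 hN')
  obtain ⟨_, ⟨k, hk, rfl⟩, hdist⟩ := Metric.mem_closure_iff.1 hcl _ hε
  have hk' : τ k = 0 := hk
  have hlt : ∀ f, |c * f.1 b - f.1 a - f.1 k| < min c (1 - c) * pureEval hunit b f := by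
    intro f
    refine ((ContinuousMap.dist_apply_le_dist f).trans_lt hdist).trans_le ?_
    exact mul_le_mul_of_nonneg_left (hbN f) (lt_min hc₀ hc₁).le
  have hbf : ∀ f, 0 ≤ pureEval hunit b f := fun f => pureEval_nonneg hunit hb.1 f
  refine ⟨a + k, nonneg_of_pureEval_pos hunit hdim fun f => ?_, sub_nonneg.1
    (nonneg_of_pureEval_pos hunit hdim fun f => ?_), by rw [map_add, hk', add_zero]⟩
  · have h₁ := (abs_lt.1 (hlt f)).2
    have h₂ := mul_le_mul_of_nonneg_right (min_le_left c (1 - c)) (hbf f)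
    simp only [map_add, ContinuousMap.add_apply, pureEval_apply] at *
    linarith
  · have h₁ := (abs_lt.1 (hlt f)).1
    have h₂ := mul_le_mul_of_nonneg_right (min_le_right c (1 - c)) (hbf f)
    simp only [map_add, map_sub, ContinuousMap.add_apply, ContinuousMap.sub_apply,
      pureEval_apply] at *
    linarith

theorem IsOrderUnitGood.eq_of_ker_le (hunit : IsOrderUnit (1 : A)) (hdim : IsDimensionGroup A)
    {τ σ : A →+ ℝ} (hτ : IsNormalizedTrace (1 : A) τ) (hσ : IsNormalizedTrace (1 : A) σ)
    (hgood : IsOrderUnitGood τ) (hker : τ.ker ≤ σ.ker) : σ = τ := by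
  obtain ⟨hτpos, hτone⟩ := isNormalizedTrace_iff.1 hτ
  obtain ⟨hσpos, hσone⟩ := isNormalizedTrace_iff.1 hσ
  have hne : (1 : A) ≠ 0 := by
    rintro h
    simp [h] at hτone
  have h1 : (0 : A) < 1 := hunit.1.lt_of_ne' hne
  have key : ∀ x, 0 < τ x → 0 ≤ σ x := by
    intro x hx
    obtain ⟨a, b, ha, hb, rfl⟩ := hdim.directed x
    rw [map_sub, sub_pos] at hx
    -- Adding `1` to both makes the upper element an order unit and the lower one nonzero, without
    -- changing their difference.
    obtain ⟨c, hc, hca, hcb⟩ := hgood (b + 1) (a + 1) (add_nonneg hb h1.le)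
      (add_pos_of_nonneg_of_pos hb h1).ne'
      ⟨add_nonneg ha h1.le, fun g => by
        obtain ⟨N, hN, h₁, h₂⟩ := hunit.2 g
        have h₃ : N • (1 : A) ≤ N • (a + 1) := nsmul_le_nsmul_right (le_add_of_nonneg_left ha) N
        exact ⟨N, hN, (neg_le_neg h₃).trans h₁, h₂.trans h₃⟩⟩
      (by rw [map_add, map_add]; linarith)
    have h₁ := map_le_of_nonneg hσpos hca
    have h₂ : σ (c - (b + 1)) = 0 := hker (by
      change τ (c - (b + 1)) = 0
      rw [map_sub, hcb, sub_self])
    simp only [map_sub, map_add] at h₁ h₂ ⊢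
    linarith
  have hle : ∀ x, τ x ≤ σ x := by
    intro x
    -- Clearing the denominator of `q` reduces `q < τ x` to the sign statement `key`.
    refine le_of_forall_rat_lt_imp_le fun q hq => ?_
    have hden : (0 : ℝ) < q.den := by exact_mod_cast q.pos
    have hqq : (q : ℝ) = (q.num : ℝ) / (q.den : ℝ) := by exact_mod_cast (Rat.num_div_den q).symm
    rw [hqq, div_lt_iff₀ hden] at hq
    have := key (q.den • x - q.num • 1) (by
      simp only [map_sub, map_nsmul, map_zsmul, hτone]
      rw [nsmul_eq_mul, zsmul_eq_mul, mul_one]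
      linarith)
    simp only [map_sub, map_nsmul, map_zsmul, hσone] at this
    rw [nsmul_eq_mul, zsmul_eq_mul, mul_one] at this
    rw [hqq, div_le_iff₀ hden]
    linarith
  ext x
  refine le_antisymm ?_ (hle x)
  have := hle (-x)
  rw [map_neg, map_neg] at this
  linarith

end Ring

end DimGroup

theorem proposition3p1 {A : Type*} [Ring A] [PartialOrder A] [IsOrderedRing A]
    (hunit : DimGroup.IsOrderUnit (1 : A))
    (hdim : DimGroup.IsDimensionGroup A)
    (hdiv : DimGroup.IsApproximatelyDivisible (1 : A)) :
    -- the pure normalized traces are exactly the multiplicative ones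
    (∀ τ : A →+ ℝ, DimGroup.IsNormalizedTrace (1 : A) τ →
      (DimGroup.IsPureTrace (1 : A) τ ↔ ∀ a b : A, τ (a * b) = τ a * τ b)) ∧
    -- the trace space is a Bauer simplex
    DimGroup.IsBauerSimplex (DimGroup.traceSpace (1 : A)) ∧
    -- restriction to the pure traces is an isometric order isomorphism `Aff S(A, 1) ≃ C(X, ℝ)`
    (∃ (_ : CompactSpace (DimGroup.traceSpace (1 : A)))
       (_ : CompactSpace (DimGroup.pureTraceSpace (1 : A)))
       (Φ : DimGroup.Aff (DimGroup.traceSpace (1 : A)) ≃ₗᵢ[ℝ]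
          C(DimGroup.pureTraceSpace (1 : A), ℝ)),
        (∀ (f : DimGroup.Aff (DimGroup.traceSpace (1 : A)))
           (x : DimGroup.pureTraceSpace (1 : A)),
          Φ f x = (f : C(DimGroup.traceSpace (1 : A), ℝ)) ⟨x.1, extremePoints_subset x.2⟩) ∧
        (∀ f : DimGroup.Aff (DimGroup.traceSpace (1 : A)),
          0 ≤ Φ f ↔ 0 ≤ (f : C(DimGroup.traceSpace (1 : A), ℝ)))) ∧
    -- order unit goodness of a pure trace
    (∀ τ : A →+ ℝ, DimGroup.IsPureTrace (1 : A) τ →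
      (DimGroup.IsOrderUnitGood τ ↔
        ∀ σ : A →+ ℝ, DimGroup.IsPureTrace (1 : A) σ → τ.ker ≤ σ.ker → σ = τ)) := by
  refine ⟨fun τ hτ => ?_, DimGroup.isBauerSimplex_traceSpace hunit hdim, ?_, fun τ hτ => ?_⟩
  · rw [DimGroup.IsPureTrace, DimGroup.mem_pureTraceSpace_iff hunit]
    exact and_iff_right (DimGroup.coe_mem_traceSpace.2 hτ)
  · have hS : CompactSpace (DimGroup.traceSpace (1 : A)) :=
      isCompact_iff_compactSpace.1 (DimGroup.isCompact_traceSpace hunit)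
    have hX : CompactSpace (DimGroup.pureTraceSpace (1 : A)) :=
      isCompact_iff_compactSpace.1 (DimGroup.isCompact_pureTraceSpace hunit)
    have : CompactSpace ((DimGroup.traceSpace (1 : A)).extremePoints ℝ) := hX
    exact ⟨hS, hX, LinearIsometryEquiv.ofSurjective
      (DimGroup.restrictExtremePointsIsometry _ (DimGroup.convex_traceSpace 1))
      (DimGroup.restrictExtremePoints_traceSpace_surjective hunit), fun f x => rfl,
      DimGroup.restrictExtremePoints_nonneg_iff (DimGroup.isCompact_traceSpace hunit)
        (DimGroup.convex_traceSpace 1)⟩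
  · exact ⟨fun h σ hσ => h.eq_of_ker_le hunit hdim hτ.isNormalizedTrace hσ.isNormalizedTrace,
      DimGroup.isOrderUnitGood_of_ker hunit hdim hdiv hτ⟩
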